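/- Let $m\ge 2$, $n\ge 1$, and let $\mathcal A=[\mathcal A_{i_1,\dots,i_m}]$ be a real tensor of order $m$ and dimension $n$ with nonnegative entries, $\mathcal A\neq 0$, that is weakly irreducible: for every nonempty proper subset $S\subset\{1,\dots,n\}$ there are $i_1\in S$ and $i_2,\dots,i_m$, at least one of them not in $S$, with $\mathcal A_{i_1,\dots,i_m}\ne 0$. (For $n\ge 2$ the condition $\mathcal A\ne0$ is automatic.) For $x\in\mathbb R^n$ put $(\mathcal A x^{m-1})_i=\sum_{i_2,\dots,i_m}\mathcal A_{i,i_2,\dots,i_m}x_{i_2}\cdots x_{i_m}$ and $x^{[\ell]}=(x_1^\ell,\dots,x_n^\ell)^\top$, and let $$F_{\mathrm H}(x,\lambda)=\begin{pmatrix}\mathcal A x^{m-1}-\lambda x^{[m-1]}\\ x^\top x-1\end{pmatrix},\qquad (x,\lambda)\in\mathbb R^n\times\mathbb R .$$ An H-eigenpair of $\mathcal A$ is a pair $(\lambda,x)\in\mathbb R\times(\mathbb R^n\setminus\{0\})$ with $\mathcal A x^{m-1}=\lambda x^{[m-1]}$. Then there is a solution $(x_*,\lambda_*)$ of $F_{\mathrm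 H}(x,\lambda)=0$ with $x_*>0$ (entrywise) and $\lambda_*>0$ such that: 1. $(x_*,\lambda_*)$ is the only solution $(x,\lambda)$ of $F_{\mathrm H}(x,\lambda)=0$ with $x>0$; equivalently, $(\lambda_*,x_*)$ is, up to positive multiples of the vector, the unique H-eigenpair of $\mathcal A$ with positive vector. Moreover $x_*$ is the only $x\ge 0$ with $F_{\mathrm H}(x,\lambda_*)=0$. 2. The Jacobian $\mathscr D_{x,\lambda}F_{\mathrm H}(x_*,\lambda_*)$ is invertible, and $(x_*,\lambda_*)$ is an isolated solution of $F_{\mathrm H}(x,\lambda)=0$ in $\mathbb R^{n+1}$. 3. Let $x_1,\dots,x_m\in\mathbb R^n$ be any entrywise positive vectors, let $(\mathcal A_0)_{i_1,\dots,i_m}=(x_1)_{i_1}\cdots(x_m)_{i_m}$, and let $H_{\mathrm H}(x,\lambda,t)$ be the map $F_{\mathrm H}$ with $\mathcal A$ replaced by $(1-t)\mathcal A_0+t\mathcal A$. Put $$x_0=\frac{x_1^{[1/(m-1)]}}{\|x_1^{[1/(m-1)]}\|_2},\qquad \lambda_0=\prod_{k=2}^m x_k^\top x_1^{[1/(m-1)]}.$$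 Then there is exactly one continuous curve $[0,1)\to\mathbb R^n\times\mathbb R$, $t\mapsto(x(t),\lambda(t))$, with $(x(0),\lambda(0))=(x_0,\lambda_0)$ and $H_{\mathrm H}(x(t),\lambda(t),t)=0$ for all $t\in[0,1)$, and $$\lim_{t\to1^-}(x(t),\lambda(t))=(x_*,\lambda_*).$$ -/

import Mathlib

open Filter Topology

/-- Real tensors of order `m` and dimension `n`. -/
abbrev RealTensor (m n : ℕ) : Type := (Fin m → Fin n) → ℝ

/-- The rank-one tensor `u 0 ∘ u 1 ∘ ⋯ ∘ u (m - 1)`. -/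
def rankOne {m n : ℕ} (u : Fin m → Fin n → ℝ) : RealTensor m n :=
  fun I => ∏ k, u k (I k)

/-- A tensor of order `d + 1` is weakly irreducible if every nonempty proper set `S` of indices
admits a nonzero entry whose first index lies in `S` and one of whose other indices does not. -/
def WeaklyIrreducible {d n : ℕ} (A : RealTensor (d + 1) n) : Prop :=
  ∀ S : Set (Fin n), S.Nonempty → S ≠ Set.univ →
    ∃ I : Fin (d + 1) → Fin n, I 0 ∈ S ∧ (∃ q, q ≠ 0 ∧ I q ∉ S) ∧ A I ≠ 0

/-- The vector `A x^{m-1}` for a tensor of order `m = d + 1`: all modes but the first are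
contracted with `x`. -/
def tensorApply {d n : ℕ} (A : RealTensor (d + 1) n) (x : Fin n → ℝ) : Fin n → ℝ :=
  fun i => ∑ J : Fin d → Fin n, A (Fin.cons i J) * ∏ k, x (J k)

/-- `(l, x)` is an H-eigenpair of a tensor of order `m = d + 1`:
`x ≠ 0` and `A x^{m-1} = l x^{[m-1]}`. -/
def IsHEigenpair {d n : ℕ} (A : RealTensor (d + 1) n) (l : ℝ) (x : Fin n → ℝ) : Prop :=
  x ≠ 0 ∧ tensorApply A x = fun i => l * x i ^ d

/-- The map `F_H(x, l) = (A x^{m-1} - l x^{[m-1]}, xᵀ x - 1)`, with `m = d + 1`. -/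
def hMap {d n : ℕ} (A : RealTensor (d + 1) n) (p : (Fin n → ℝ) × ℝ) : (Fin n → ℝ) × ℝ :=
  (fun i => tensorApply A p.1 i - p.2 * p.1 i ^ d, p.1 ⬝ᵥ p.1 - 1)

/-- The linear homotopy `H_H(x, l, t)`, that is, `F_H` of the tensor `(1 - t) A₀ + t A`. -/
def hHomotopy {d n : ℕ} (A₀ A : RealTensor (d + 1) n) (p : (Fin n → ℝ) × ℝ) (t : ℝ) :
    (Fin n → ℝ) × ℝ :=
  hMap ((1 - t) • A₀ + t • A) p

/-- The entrywise root `(u 0)^{[1/(m-1)]}`, with `m = d + 1`. -/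
noncomputable def rootVector {d n : ℕ} (u : Fin (d + 1) → Fin n → ℝ) : Fin n → ℝ :=
  fun i => u 0 i ^ (1 / (d : ℝ))

/-- The starting point `(x₀, l₀)`: `x₀` is the root vector divided by its Euclidean norm, and `l₀`
is the product of the inner products of the root vector with all `u k` but the first. -/
noncomputable def hStart {d n : ℕ} (u : Fin (d + 1) → Fin n → ℝ) : (Fin n → ℝ) × ℝ :=
  ((√(rootVector u ⬝ᵥ rootVector u))⁻¹ • rootVector u,
    ∏ k : Fin d, u k.succ ⬝ᵥ rootVector u)

/-- `c` is, on `[0, 1)`, a continuous solution curve of the homotopy from `rankOne u` to `A` that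
starts at `hStart u`. Values of `c` outside `[0, 1)` play no role. -/
def IsHCurve {d n : ℕ} (u : Fin (d + 1) → Fin n → ℝ) (A : RealTensor (d + 1) n)
    (c : ℝ → (Fin n → ℝ) × ℝ) : Prop :=
  ContinuousOn c (Set.Ico 0 1) ∧ c 0 = hStart u ∧
    ∀ t ∈ Set.Ico (0 : ℝ) 1, hHomotopy (rankOne u) A (c t) t = 0

/-- `p` is an isolated zero of `f`. -/
def IsIsolatedZero {E F : Type*} [TopologicalSpace E] [Zero F] (f : E → F) (p : E) : Prop :=
  f p = 0 ∧ ∀ᶠ q in 𝓝[≠] p, f q ≠ 0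

/-!
The proof rests on a maximum principle. Let `z > 0` be an eigenvector with eigenvalue `l`, let
`x ≥ 0` be one with eigenvalue `l'`, and look at an index where `x i / z i` is largest: there the
eigenvalue equations give `l' ≤ l`, and if `l' = l` every nonzero entry of `A` leads from a
maximizing index to maximizing indices only, so that `x` is a multiple of `z` by weak
irreducibility. This gives the uniqueness claims (`eigenvalue_le_of_pos`,
`exists_eq_smul_of_eigenvalue_eq`). The linearization of the argument, with directions of `x`
written as `x * w`, shows that a kernel vector of the Jacobian has `w` constant and hence vanishes
by the normalization (`fderiv_hMap_injective`), which gives invertibility and isolation.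

For every `t` in `[0, 1]` the tensor `(1 - t) A₀ + t A` is nonnegative and weakly irreducible, so it
has at most one positive solution, which is nondegenerate and persists for nearby parameters
(`eventually_exists_pos_zero`). Positive solutions cannot escape to the boundary of the orthant as
`t` varies, since weak irreducibility bounds the ratios of their entries uniformly
(`WeaklyIrreducible.exists_ratio_bound`, `exists_compact_bound`). The parameters admitting a positive
solution thus form an open and closed subset of `[0, 1]` containing `0`, where the rank-one tensor
has an explicit solution. So the positive solution exists at every `t`, which proves the existence
of a positive eigenpair of `A` at `t = 1`, and it depends continuously on `t` up to and including
`1`. Any other continuous solution curve from the same starting point agrees with it by another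
connectedness argument (`eqOn_pos_curve`).
-/

/-! ### Tensor application -/

theorem tensorApply_smul {d n : ℕ} (A : RealTensor (d + 1) n) (a : ℝ) (x : Fin n → ℝ) (i : Fin n) :
    tensorApply A (a • x) i = a ^ d * tensorApply A x i := by
  simp only [tensorApply, Pi.smul_apply, smul_eq_mul, Finset.prod_mul_distrib, Finset.prod_const,
    Finset.card_univ, Fintype.card_fin, Finset.mul_sum]
  exact Finset.sum_congr rfl fun J _ => by ring

theorem tensorApply_mono {d n : ℕ} {A : RealTensor (d + 1) n} (hA : ∀ I, 0 ≤ A I)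
    {x y : Fin n → ℝ} (hx : ∀ i, 0 ≤ x i) (hxy : ∀ i, x i ≤ y i) (i : Fin n) :
    tensorApply A x i ≤ tensorApply A y i :=
  Finset.sum_le_sum fun _ _ => mul_le_mul_of_nonneg_left
    (Finset.prod_le_prod (fun _ _ => hx _) fun _ _ => hxy _) (hA _)

theorem mul_prod_le_tensorApply {d n : ℕ} {A : RealTensor (d + 1) n} (hA : ∀ I, 0 ≤ A I)
    {x : Fin n → ℝ} (hx : ∀ i, 0 ≤ x i) (I : Fin (d + 1) → Fin n) :
    A I * ∏ k : Fin d, x (I k.succ) ≤ tensorApply A x (I 0) := by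
  have h := Finset.single_le_sum (f := fun J : Fin d → Fin n => A (Fin.cons (I 0) J) * ∏ k, x (J k))
    (fun J _ => mul_nonneg (hA _) (Finset.prod_nonneg fun k _ => hx _))
    (Finset.mem_univ (Fin.tail I))
  rw [Fin.cons_self_tail] at h
  exact h

theorem tensorApply_rankOne {d n : ℕ} (u : Fin (d + 1) → Fin n → ℝ) (x : Fin n → ℝ) (i : Fin n) :
    tensorApply (rankOne u) x i = u 0 i * ∏ k : Fin d, u k.succ ⬝ᵥ x := by
  simp only [tensorApply, rankOne, Fin.prod_univ_succ, Fin.cons_zero, Fin.cons_succ, dotProduct]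
  rw [Fintype.prod_sum, Finset.mul_sum]
  refine Finset.sum_congr rfl fun J _ => ?_
  rw [Finset.prod_mul_distrib, mul_assoc]

theorem hMap_eq_zero_iff {d n : ℕ} {A : RealTensor (d + 1) n} {p : (Fin n → ℝ) × ℝ} :
    hMap A p = 0 ↔ (∀ i, tensorApply A p.1 i = p.2 * p.1 i ^ d) ∧ p.1 ⬝ᵥ p.1 = 1 := by
  simp only [hMap, Prod.ext_iff, Prod.fst_zero, Prod.snd_zero, funext_iff, Pi.zero_apply,
    sub_eq_zero]

/-- The contrapositive form of weak irreducibility: a nonempty set of indices closed under the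
nonzero entries of `A` is everything. -/
theorem WeaklyIrreducible.eq_univ {d n : ℕ} {A : RealTensor (d + 1) n} (h : WeaklyIrreducible A)
    {S : Set (Fin n)} (hS : S.Nonempty)
    (hcl : ∀ I, A I ≠ 0 → I 0 ∈ S → ∀ k : Fin d, I k.succ ∈ S) : S = Set.univ := by
  by_contra hne
  obtain ⟨I, hI0, ⟨q, hq, hqS⟩, hAI⟩ := h S hS hne
  obtain ⟨k, rfl⟩ := Fin.exists_succ_eq.2 hq
  exact hqS (hcl I hAI hI0 k)

theorem weaklyIrreducible_of_pos {d n : ℕ} (hd : 1 ≤ d) {A : RealTensor (d + 1) n}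
    (hA : ∀ I, 0 < A I) : WeaklyIrreducible A := by
  intro S ⟨i, hi⟩ hS
  obtain ⟨j, hj⟩ := (Set.ne_univ_iff_exists_notMem S).1 hS
  exact ⟨Fin.cons i fun _ => j, hi, ⟨Fin.succ ⟨0, hd⟩, Fin.succ_ne_zero _, hj⟩, (hA _).ne'⟩

/-! ### Comparison with a positive eigenvector -/

/-- The largest ratio `M = x i / z i`: the least multiple of `z` dominating `x`. -/
theorem exists_max_ratio {n : ℕ} {x z : Fin n → ℝ} (hz : ∀ i, 0 < z i) (hx : ∀ i, 0 ≤ x i)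
    (hx0 : x ≠ 0) : ∃ M : ℝ, 0 < M ∧ (∃ i, x i = M * z i) ∧ ∀ j, x j ≤ M * z j := by
  obtain ⟨i₀, hi₀⟩ := Function.ne_iff.1 hx0
  have : Nonempty (Fin n) := ⟨i₀⟩
  obtain ⟨i, hi⟩ := Finite.exists_max fun i => x i / z i
  refine ⟨x i / z i, ?_, ⟨i, (div_mul_cancel₀ _ (hz i).ne').symm⟩,
    fun j => (div_le_iff₀ (hz j)).1 (hi j)⟩
  exact (div_pos ((hx i₀).lt_of_ne' hi₀) (hz i₀)).trans_le (hi i₀)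

/-- A positive eigenvector has the largest eigenvalue among nonnegative eigenvectors: compare `x`
with `M z` at a coordinate where they touch. -/
theorem eigenvalue_le_of_pos {d n : ℕ} {A : RealTensor (d + 1) n} (hA : ∀ I, 0 ≤ A I)
    {x z : Fin n → ℝ} {l l' : ℝ} (hz : ∀ i, 0 < z i) (hzl : ∀ i, tensorApply A z i = l * z i ^ d)
    (hx : ∀ i, 0 ≤ x i) (hx0 : x ≠ 0) (hxl : ∀ i, tensorApply A x i = l' * x i ^ d) : l' ≤ l := by
  obtain ⟨M, hM, ⟨i, hi⟩, hle⟩ := exists_max_ratio hz hx hx0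
  have h : tensorApply A x i ≤ tensorApply A (M • z) i := tensorApply_mono hA hx hle i
  rw [tensorApply_smul, hxl, hzl, hi, mul_pow, mul_left_comm (M ^ d)] at h
  exact le_of_mul_le_mul_right h (mul_pos (pow_pos hM d) (pow_pos (hz i) d))

theorem forall_eq_of_prod_eq_prod {ι : Type*} [Fintype ι] {a b : ι → ℝ} (ha : ∀ k, 0 ≤ a k)
    (hab : ∀ k, a k ≤ b k) (hb : ∀ k, 0 < b k) (h : ∏ k, a k = ∏ k, b k) (k : ι) : a k = b k := by
  by_contra hne
  have hpos : 0 < ∏ k, a k := h ▸ Finset.prod_pos fun k _ => hb k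
  have ha' : ∀ k, 0 < a k := fun k =>
    (ha k).lt_of_ne' (Finset.prod_ne_zero_iff.1 hpos.ne' k (Finset.mem_univ k))
  exact (Finset.prod_lt_prod (fun k _ => ha' k) (fun k _ => hab k)
    ⟨k, Finset.mem_univ k, (hab k).lt_of_ne hne⟩).ne h

/-- Where the ratio `x i / z i` is maximal, equality must hold in every term of the contraction,
so the set of maximizers is closed under the nonzero entries of `A`. -/
theorem exists_eq_smul_of_eigenvalue_eq {d n : ℕ} {A : RealTensor (d + 1) n} (hA : ∀ I, 0 ≤ A I)
    (hirr : WeaklyIrreducible A) {x z : Fin n → ℝ} {l : ℝ} (hz : ∀ i, 0 < z i)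
    (hzl : ∀ i, tensorApply A z i = l * z i ^ d) (hx : ∀ i, 0 ≤ x i) (hx0 : x ≠ 0)
    (hxl : ∀ i, tensorApply A x i = l * x i ^ d) : ∃ M : ℝ, 0 < M ∧ x = M • z := by
  obtain ⟨M, hM, ⟨i, hi⟩, hle⟩ := exists_max_ratio hz hx hx0
  refine ⟨M, hM, ?_⟩
  have hS : {i | x i = M * z i} = Set.univ := by
    refine hirr.eq_univ ⟨i, hi⟩ fun I hI (hI0 : x (I 0) = M * z (I 0)) => ?_
    have heq : tensorApply A x (I 0) = tensorApply A (M • z) (I 0) := by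
      rw [tensorApply_smul, hxl, hzl, hI0, mul_pow]; ring
    have hterm := (Finset.sum_eq_sum_iff_of_le fun J _ => mul_le_mul_of_nonneg_left
      (Finset.prod_le_prod (fun k _ => hx (J k)) fun k _ => hle (J k)) (hA _)).1 heq
      (Fin.tail I) (Finset.mem_univ _)
    rw [Fin.cons_self_tail] at hterm
    exact forall_eq_of_prod_eq_prod (fun _ => hx _) (fun _ => hle _)
      (fun _ => mul_pos hM (hz _)) (mul_left_cancel₀ hI hterm)
  funext i
  exact (hS ▸ Set.mem_univ i : i ∈ {i | x i = M * z i})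

theorem eq_of_hMap_eq_zero_of_nonneg {d n : ℕ} {A : RealTensor (d + 1) n} (hA : ∀ I, 0 ≤ A I)
    (hirr : WeaklyIrreducible A) {x z : Fin n → ℝ} {l : ℝ} (hz : ∀ i, 0 < z i)
    (hzl : hMap A (z, l) = 0) (hx : ∀ i, 0 ≤ x i) (hxl : hMap A (x, l) = 0) : x = z := by
  rw [hMap_eq_zero_iff] at hzl hxl
  obtain ⟨hzl, hz1⟩ := hzl
  obtain ⟨hxl, hx1⟩ := hxl
  have hx0 : x ≠ 0 := by rintro rfl; simp at hx1
  obtain ⟨M, hM, rfl⟩ := exists_eq_smul_of_eigenvalue_eq hA hirr hz hzl hx hx0 hxl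
  simp only [smul_dotProduct, dotProduct_smul, hz1, smul_eq_mul, mul_one] at hx1
  have : M = 1 := by nlinarith
  rw [this, one_smul]

theorem eigenvalue_eq_of_pos {d n : ℕ} {A : RealTensor (d + 1) n} (hA : ∀ I, 0 ≤ A I)
    {x z : Fin n → ℝ} {l l' : ℝ} (hz : ∀ i, 0 < z i) (hz0 : z ≠ 0)
    (hzl : ∀ i, tensorApply A z i = l * z i ^ d) (hx : ∀ i, 0 < x i) (hx0 : x ≠ 0)
    (hxl : ∀ i, tensorApply A x i = l' * x i ^ d) : l' = l :=
  le_antisymm (eigenvalue_le_of_pos hA hz hzl (fun i => (hx i).le) hx0 hxl)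
    (eigenvalue_le_of_pos hA hx hxl (fun i => (hz i).le) hz0 hzl)

theorem eq_of_hMap_eq_zero_of_pos {d n : ℕ} {A : RealTensor (d + 1) n} (hA : ∀ I, 0 ≤ A I)
    (hirr : WeaklyIrreducible A) {p q : (Fin n → ℝ) × ℝ} (hp : ∀ i, 0 < p.1 i)
    (hpl : hMap A p = 0) (hq : ∀ i, 0 < q.1 i) (hql : hMap A q = 0) : q = p := by
  obtain ⟨z, l⟩ := p
  obtain ⟨x, l'⟩ := q
  have hp' := hMap_eq_zero_iff.1 hpl
  have hq' := hMap_eq_zero_iff.1 hql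
  have hx0 : x ≠ 0 := by rintro rfl; simp at hq'
  have hz0 : z ≠ 0 := by rintro rfl; simp at hp'
  obtain rfl : l' = l := eigenvalue_eq_of_pos hA hp hz0 hp'.1 hq hx0 hq'.1
  exact congrArg (·, l') (eq_of_hMap_eq_zero_of_nonneg hA hirr hp hpl (fun i => (hq i).le) hql)

/-! ### Invertibility of the Jacobian -/

theorem contDiff_hMap {d n : ℕ} (A : RealTensor (d + 1) n) : ContDiff ℝ 1 (hMap A) := by
  unfold hMap tensorApply dotProduct
  fun_prop

theorem contDiff_hHomotopy {d n : ℕ} (A₀ A : RealTensor (d + 1) n) :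
    ContDiff ℝ 1 fun q : ((Fin n → ℝ) × ℝ) × ℝ => hHomotopy A₀ A q.1 q.2 := by
  simp only [hHomotopy, hMap, tensorApply, dotProduct, Pi.add_apply, Pi.smul_apply, smul_eq_mul]
  fun_prop

/-- Logarithmic derivative of a product, in a form that allows zero factors. -/
theorem hasDerivAt_prod_rel {ι : Type*} [Fintype ι] (a b : ι → ℝ) :
    HasDerivAt (fun s : ℝ => ∏ k, (a k + s * (a k * b k))) ((∏ k, a k) * ∑ k, b k) 0 := by
  classical
  have h (k : ι) : HasDerivAt (fun s : ℝ => a k + s * (a k * b k)) (a k * b k) 0 := by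
    simpa using ((hasDerivAt_id (0 : ℝ)).mul_const (a k * b k)).const_add (a k)
  refine (HasDerivAt.fun_finsetProd fun k (_ : k ∈ Finset.univ) => h k).congr_deriv ?_
  rw [Finset.mul_sum]
  refine Finset.sum_congr rfl fun k hk => ?_
  rw [← Finset.prod_erase_mul _ _ hk]
  simp [mul_assoc]

/-- The Jacobian of `F_H` in relative coordinates: the direction of `x` is written `x * w`. -/
theorem fderiv_hMap_apply {d n : ℕ} (A : RealTensor (d + 1) n) (x w : Fin n → ℝ) (l μ : ℝ) :
    fderiv ℝ (hMap A) (x, l) (x * w, μ) =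
      (fun i => ∑ J : Fin d → Fin n, A (Fin.cons i J) * ((∏ k, x (J k)) * ∑ k, w (J k)) -
        (μ * x i ^ d + l * (x i ^ d * (d * w i))),
      ∑ i, x i ^ 2 * (2 * w i)) := by
  have hline : HasDerivAt (fun s : ℝ => (x, l) + s • (x * w, μ)) (x * w, μ) 0 := by
    simpa using ((hasDerivAt_id (0 : ℝ)).smul_const (x * w, μ)).const_add (x, l)
  have hf : HasFDerivAt (hMap A) (fderiv ℝ (hMap A) (x, l)) ((x, l) + (0 : ℝ) • (x * w, μ)) := by
    simpa using ((contDiff_hMap A).differentiable one_ne_zero (x, l)).hasFDerivAt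
  refine (hf.comp_hasDerivAt 0 hline).unique ?_
  refine HasDerivAt.prodMk (hasDerivAt_pi.2 fun i => ?_) ?_
  · have hpow : HasDerivAt (fun s : ℝ => (x i + s * (x i * w i)) ^ d) (x i ^ d * (d * w i)) 0 := by
      simpa using hasDerivAt_prod_rel (fun _ : Fin d => x i) fun _ => w i
    have hl : HasDerivAt (fun s : ℝ => l + s * μ) μ 0 := by
      simpa using ((hasDerivAt_id (0 : ℝ)).mul_const μ).const_add l
    refine (HasDerivAt.sub (f := fun s : ℝ => ∑ J : Fin d → Fin n, A (Fin.cons i J) *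
      ∏ k, (x (J k) + s * (x (J k) * w (J k)))) (HasDerivAt.fun_sum fun J _ =>
        (hasDerivAt_prod_rel (fun k => x (J k)) fun k => w (J k)).const_mul _)
      (hl.mul hpow)).congr_deriv ?_
    simp
  · have h (i : Fin n) : HasDerivAt (fun s : ℝ => (x i + s * (x i * w i)) * (x i + s * (x i * w i)))
        (x i ^ 2 * (2 * w i)) 0 := by
      simpa [sq, two_mul] using hasDerivAt_prod_rel (fun _ : Fin 2 => x i) fun _ => w i
    exact (HasDerivAt.fun_sum fun i _ => h i).sub_const 1

/-- The first block of the Jacobian's kernel equation, with the eigenvalue eliminated. -/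
theorem sum_mul_sum_sub_eq {d n : ℕ} {A : RealTensor (d + 1) n} {x w : Fin n → ℝ} {l μ : ℝ}
    (hxl : ∀ i, tensorApply A x i = l * x i ^ d) {i : Fin n}
    (h : ∑ J : Fin d → Fin n, A (Fin.cons i J) * ((∏ k, x (J k)) * ∑ k, w (J k)) -
        (μ * x i ^ d + l * (x i ^ d * (d * w i))) = 0) :
    ∑ J : Fin d → Fin n, A (Fin.cons i J) * ((∏ k, x (J k)) * ∑ k, (w i - w (J k))) =
      -μ * x i ^ d := by
  have h1 : ∑ J : Fin d → Fin n, A (Fin.cons i J) * ((∏ k, x (J k)) * ∑ k, (w i - w (J k))) =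
      tensorApply A x i * (d * w i) -
        ∑ J : Fin d → Fin n, A (Fin.cons i J) * ((∏ k, x (J k)) * ∑ k, w (J k)) := by
    rw [tensorApply, Finset.sum_mul, ← Finset.sum_sub_distrib]
    refine Finset.sum_congr rfl fun J _ => ?_
    simp only [Finset.sum_sub_distrib, Finset.sum_const, Finset.card_univ, Fintype.card_fin,
      nsmul_eq_mul]
    ring
  rw [h1, hxl]
  linarith

/-- The left-hand side is nonnegative where `w` is maximal. Applied to `w` and to `-w`, this gives
`μ = 0`. -/
theorem nonpos_of_kernel {d n : ℕ} [Nonempty (Fin n)] {A : RealTensor (d + 1) n}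
    (hA : ∀ I, 0 ≤ A I) {x w : Fin n → ℝ} {μ : ℝ} (hx : ∀ i, 0 < x i)
    (h : ∀ i, ∑ J : Fin d → Fin n, A (Fin.cons i J) * ((∏ k, x (J k)) * ∑ k, (w i - w (J k))) =
      -μ * x i ^ d) : μ ≤ 0 := by
  obtain ⟨i, hi⟩ := Finite.exists_max w
  have h0 : 0 ≤ -μ * x i ^ d := by
    rw [← h i]
    exact Finset.sum_nonneg fun J _ => mul_nonneg (hA _) (mul_nonneg
      (Finset.prod_nonneg fun k _ => (hx _).le) (Finset.sum_nonneg fun k _ => sub_nonneg.2 (hi _)))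
  have := nonneg_of_mul_nonneg_left h0 (pow_pos (hx i) d)
  linarith

/-- Linear counterpart of `exists_eq_smul_of_eigenvalue_eq`: the set where `w` is maximal is closed
under the nonzero entries of `A`. -/
theorem eq_const_of_kernel {d n : ℕ} [Nonempty (Fin n)] {A : RealTensor (d + 1) n}
    (hA : ∀ I, 0 ≤ A I) (hirr : WeaklyIrreducible A) {x w : Fin n → ℝ} (hx : ∀ i, 0 < x i)
    (h : ∀ i, ∑ J : Fin d → Fin n, A (Fin.cons i J) * ((∏ k, x (J k)) * ∑ k, (w i - w (J k))) = 0) :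
    ∃ c, ∀ i, w i = c := by
  obtain ⟨i, hi⟩ := Finite.exists_max w
  refine ⟨w i, ?_⟩
  have hS : {j | w j = w i} = Set.univ := by
    refine hirr.eq_univ ⟨i, rfl⟩ fun I hI (hI0 : w (I 0) = w i) => ?_
    have hdiff : ∀ j, 0 ≤ w (I 0) - w j := fun j => by rw [hI0]; exact sub_nonneg.2 (hi j)
    have hterm := (Finset.sum_eq_zero_iff_of_nonneg fun J _ => mul_nonneg (hA _) (mul_nonneg
      (Finset.prod_nonneg fun k _ => (hx (J k)).le)
      (Finset.sum_nonneg fun k _ => hdiff (J k)))).1 (h (I 0)) (Fin.tail I) (Finset.mem_univ _)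
    rw [Fin.cons_self_tail] at hterm
    have hsum := ((mul_eq_zero.1 hterm).resolve_left hI)
    have hsum := (mul_eq_zero.1 hsum).resolve_left (Finset.prod_pos fun k _ => hx _).ne'
    intro k
    have := (Finset.sum_eq_zero_iff_of_nonneg fun k _ => hdiff _).1 hsum k (Finset.mem_univ k)
    exact (sub_eq_zero.1 this).symm.trans hI0
  exact fun j => (hS ▸ Set.mem_univ j : j ∈ {j | w j = w i})

/-- A kernel vector `(x * w, μ)` has `μ = 0` and `w` constant, and the normalization row
`2 xᵀ (x * w) = 0` makes the constant vanish. -/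
theorem fderiv_hMap_injective {d n : ℕ} {A : RealTensor (d + 1) n} (hA : ∀ I, 0 ≤ A I)
    (hirr : WeaklyIrreducible A) {p : (Fin n → ℝ) × ℝ} (hp : ∀ i, 0 < p.1 i)
    (hp0 : hMap A p = 0) : Function.Injective (fderiv ℝ (hMap A) p) := by
  obtain ⟨x, l⟩ := p
  obtain ⟨hxl, hx1⟩ := hMap_eq_zero_iff.1 hp0
  simp only at hp hxl hx1
  have : Nonempty (Fin n) := by
    by_contra hne
    rw [not_nonempty_iff] at hne
    simp [dotProduct] at hx1
  rw [injective_iff_map_eq_zero]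
  rintro ⟨v, μ⟩ hv
  obtain ⟨w, rfl⟩ : ∃ w, v = x * w :=
    ⟨v / x, by funext i; exact (mul_div_cancel₀ (v i) (hp i).ne').symm⟩
  rw [fderiv_hMap_apply] at hv
  simp only [Prod.ext_iff, funext_iff, Prod.fst_zero, Prod.snd_zero, Pi.zero_apply] at hv
  have hk := fun i => sum_mul_sum_sub_eq hxl (hv.1 i)
  have hμ : μ ≤ 0 := nonpos_of_kernel hA hp hk
  have hμ' : -μ ≤ 0 := nonpos_of_kernel (w := -w) hA hp fun i => by
    rw [neg_mul, ← hk i, ← Finset.sum_neg_distrib]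
    refine Finset.sum_congr rfl fun J _ => ?_
    rw [← mul_neg, ← mul_neg, ← Finset.sum_neg_distrib]
    simp only [Pi.neg_apply]
    congr 2
    exact Finset.sum_congr rfl fun k _ => by ring
  obtain rfl : μ = 0 := by linarith
  obtain ⟨c, hc⟩ := eq_const_of_kernel hA hirr hp fun i => by simpa using hk i
  have hc0 : c = 0 := by
    have h2 := hv.2
    have : ∑ i, x i ^ 2 * (2 * w i) = (x ⬝ᵥ x) * (2 * c) := by
      rw [dotProduct, Finset.sum_mul]
      exact Finset.sum_congr rfl fun i _ => by rw [hc]; ring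
    rw [this, hx1] at h2
    linarith
  ext i
  · simp [hc, hc0]
  · rfl

theorem isInvertible_of_injective {E : Type*} [NormedAddCommGroup E] [NormedSpace ℝ E]
    [FiniteDimensional ℝ E] {f : E →L[ℝ] E} (hf : Function.Injective f) : f.IsInvertible :=
  ⟨(LinearEquiv.ofInjectiveEndo (f : E →ₗ[ℝ] E) hf).toContinuousLinearEquiv, by ext; rfl⟩

theorem isIsolatedZero_of_isInvertible {E : Type*} [NormedAddCommGroup E] [NormedSpace ℝ E]
    {f : E → E} {p : E} (hf : DifferentiableAt ℝ f p) (hinv : (fderiv ℝ f p).IsInvertible)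
    (h0 : f p = 0) : IsIsolatedZero f p := by
  obtain ⟨e, he⟩ := hinv
  have h := hf.hasFDerivAt
  rw [← he] at h
  exact ⟨h0, h.eventually_ne ⟨_, e.antilipschitz⟩⟩

/-! ### A priori bounds -/

/-- Harnack-type inequality: weak irreducibility bounds the ratios of the entries of a positive `x`
with `B x^{m-1} ≤ Λ x^{[m-1]}`, uniformly over all `B` bounded below on the support of `A`. The set
of entries comparable with the smallest one can be enlarged as long as it is proper, because a
nonzero entry of `A` links it to its complement. -/
theorem WeaklyIrreducible.exists_ratio_bound {d n : ℕ} {A : RealTensor (d + 1) n}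
    (hirr : WeaklyIrreducible A) {a Λ : ℝ} (ha : 0 < a) (hΛ : 0 ≤ Λ) :
    ∃ C : ℝ, 1 ≤ C ∧ ∀ B : RealTensor (d + 1) n, (∀ I, 0 ≤ B I) → (∀ I, A I ≠ 0 → a ≤ B I) →
      ∀ x : Fin n → ℝ, (∀ i, 0 < x i) → (∀ i, tensorApply B x i ≤ Λ * x i ^ d) →
        ∀ i j, x i ≤ C * x j := by
  have key : ∀ k : ℕ, ∃ C : ℝ, 1 ≤ C ∧ ∀ B : RealTensor (d + 1) n, (∀ I, 0 ≤ B I) →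
      (∀ I, A I ≠ 0 → a ≤ B I) → ∀ x : Fin n → ℝ, (∀ i, 0 < x i) →
      (∀ i, tensorApply B x i ≤ Λ * x i ^ d) → ∀ j, (∀ i, x j ≤ x i) →
      ∃ S : Finset (Fin n), S.Nonempty ∧ (S = Finset.univ ∨ k < S.card) ∧
        ∀ i ∈ S, x i ≤ C * x j := by
    intro k
    induction k with
    | zero =>
      refine ⟨1, le_rfl, fun B _ _ x _ _ j _ => ⟨{j}, ⟨j, by simp⟩, Or.inr (by simp), ?_⟩⟩
      simp
    | succ k ih =>
      obtain ⟨C, hC, ih⟩ := ih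
      refine ⟨max C (Λ * C ^ d / a), hC.trans (le_max_left _ _), fun B hB hAB x hx hxB j hj => ?_⟩
      obtain ⟨S, hS, hSk, hSC⟩ := ih B hB hAB x hx hxB j hj
      have hSC' : ∀ i ∈ S, x i ≤ max C (Λ * C ^ d / a) * x j := fun i hi =>
        (hSC i hi).trans (mul_le_mul_of_nonneg_right (le_max_left _ _) (hx j).le)
      by_cases hSu : S = Finset.univ
      · exact ⟨S, hS, Or.inl hSu, hSC'⟩
      obtain ⟨I, hI0, ⟨q, hq, hqS⟩, hAI⟩ := hirr S hS (by simpa using hSu)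
      obtain ⟨r, rfl⟩ := Fin.exists_succ_eq.2 hq
      refine ⟨insert (I r.succ) S, Finset.insert_nonempty _ _, Or.inr ?_, fun i hi => ?_⟩
      · rw [Finset.card_insert_of_notMem (by simpa using hqS)]
        have := hSk.resolve_left hSu
        omega
      rcases Finset.mem_insert.1 hi with rfl | hi
      · have hd : d ≠ 0 := by have := r.pos; omega
        have hm := hx j
        have hprod : x (I r.succ) * x j ^ (d - 1) ≤ ∏ k : Fin d, x (I k.succ) := by
          rw [← Finset.mul_prod_erase _ _ (Finset.mem_univ r)]
          refine mul_le_mul_of_nonneg_left ?_ (hx _).le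
          refine le_trans (le_of_eq ?_) (Finset.prod_le_prod (f := fun _ => x j)
            (fun _ _ => hm.le) fun k _ => hj _)
          simp
        have h1 : a * (x (I r.succ) * x j ^ (d - 1)) ≤ Λ * (C * x j) ^ d :=
          calc a * (x (I r.succ) * x j ^ (d - 1)) ≤ B I * ∏ k : Fin d, x (I k.succ) :=
                mul_le_mul (hAB I hAI) hprod (mul_pos (hx _) (pow_pos hm _)).le (hB I)
            _ ≤ tensorApply B x (I 0) := mul_prod_le_tensorApply hB (fun i => (hx i).le) I
            _ ≤ Λ * x (I 0) ^ d := hxB _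
            _ ≤ Λ * (C * x j) ^ d := mul_le_mul_of_nonneg_left
                (pow_le_pow_left₀ (hx _).le (hSC _ (by simpa using hI0)) d) hΛ
        have h2 : x (I r.succ) ≤ Λ * C ^ d / a * x j := by
          rw [div_mul_eq_mul_div, le_div_iff₀ ha]
          refine le_of_mul_le_mul_right ?_ (pow_pos hm (d - 1))
          calc x (I r.succ) * a * x j ^ (d - 1) = a * (x (I r.succ) * x j ^ (d - 1)) := by ring
            _ ≤ Λ * (C * x j) ^ d := h1
            _ = Λ * C ^ d * x j * x j ^ (d - 1) := by
                rw [mul_pow, ← mul_pow_sub_one hd (x j)]; ring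
        exact h2.trans (mul_le_mul_of_nonneg_right (le_max_right _ _) hm.le)
      · exact hSC' i hi
  obtain ⟨C, hC, h⟩ := key n
  refine ⟨C, hC, fun B hB hAB x hx hxB i j => ?_⟩
  have : Nonempty (Fin n) := ⟨i⟩
  obtain ⟨j₀, hj₀⟩ := Finite.exists_min x
  obtain ⟨S, -, hSn, hS⟩ := h B hB hAB x hx hxB j₀ hj₀
  have hSu : S = Finset.univ := hSn.resolve_right (by simpa using S.card_le_univ)
  exact (hS i (hSu ▸ Finset.mem_univ i)).trans
    (mul_le_mul_of_nonneg_left (hj₀ j) (zero_le_one.trans hC))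

theorem eigenvalue_nonneg {d n : ℕ} {A : RealTensor (d + 1) n} (hA : ∀ I, 0 ≤ A I)
    {x : Fin n → ℝ} {l : ℝ} (hx : ∀ i, 0 < x i) (i : Fin n)
    (hxl : tensorApply A x i = l * x i ^ d) : 0 ≤ l := by
  refine nonneg_of_mul_nonneg_left (hxl ▸ ?_) (pow_pos (hx i) d)
  exact Finset.sum_nonneg fun J _ => mul_nonneg (hA _) (Finset.prod_nonneg fun k _ => (hx _).le)

theorem eigenvalue_le_sum {d n : ℕ} [Nonempty (Fin n)] {A : RealTensor (d + 1) n}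
    (hA : ∀ I, 0 ≤ A I) {x : Fin n → ℝ} {l : ℝ} (hx : ∀ i, 0 < x i)
    (hxl : ∀ i, tensorApply A x i = l * x i ^ d) : l ≤ ∑ I, A I := by
  obtain ⟨i, hi⟩ := Finite.exists_max x
  refine le_of_mul_le_mul_right ?_ (pow_pos (hx i) d)
  rw [← hxl i]
  calc tensorApply A x i ≤ ∑ J : Fin d → Fin n, A (Fin.cons i J) * x i ^ d := by
        refine Finset.sum_le_sum fun J _ => mul_le_mul_of_nonneg_left ?_ (hA _)
        refine (Finset.prod_le_prod (fun k _ => (hx _).le) fun k _ => hi (J k)).trans_eq ?_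
        simp
    _ = (∑ J : Fin d → Fin n, A (Fin.cons i J)) * x i ^ d := (Finset.sum_mul _ _ _).symm
    _ ≤ (∑ I, A I) * x i ^ d := by
        refine mul_le_mul_of_nonneg_right ?_ (pow_pos (hx i) d).le
        rw [← Finset.sum_image (s := Finset.univ) (f := A)
          (g := fun J : Fin d → Fin n => (Fin.cons i J : Fin (d + 1) → Fin n))
          (fun J _ J' _ h => Fin.cons_right_injective (α := fun _ => Fin n) i h)]
        exact Finset.sum_le_sum_of_subset_of_nonneg (Finset.subset_univ _) fun I _ _ => hA I

/-! ### Positive solutions along the homotopy -/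

/-- The tensor `(1 - t) A₀ + t A`. -/
abbrev homotopyTensor {d n : ℕ} (A₀ A : RealTensor (d + 1) n) (t : ℝ) : RealTensor (d + 1) n :=
  (1 - t) • A₀ + t • A

theorem homotopyTensor_nonneg {d n : ℕ} {A₀ A : RealTensor (d + 1) n} (hA₀ : ∀ I, 0 < A₀ I)
    (hA : ∀ I, 0 ≤ A I) {t : ℝ} (ht : t ∈ Set.Icc (0 : ℝ) 1) (I : Fin (d + 1) → Fin n) :
    0 ≤ homotopyTensor A₀ A t I :=
  add_nonneg (mul_nonneg (sub_nonneg.2 ht.2) (hA₀ I).le) (mul_nonneg ht.1 (hA I))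

theorem homotopyTensor_weaklyIrreducible {d n : ℕ} (hd : 1 ≤ d) {A₀ A : RealTensor (d + 1) n}
    (hA₀ : ∀ I, 0 < A₀ I) (hA : ∀ I, 0 ≤ A I) (hirr : WeaklyIrreducible A) {t : ℝ}
    (ht : t ∈ Set.Icc (0 : ℝ) 1) : WeaklyIrreducible (homotopyTensor A₀ A t) := by
  rcases ht.2.eq_or_lt with rfl | h1
  · simpa [homotopyTensor] using hirr
  · exact weaklyIrreducible_of_pos hd fun I =>
      add_pos_of_pos_of_nonneg (mul_pos (sub_pos.2 h1) (hA₀ I)) (mul_nonneg ht.1 (hA I))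

theorem eq_of_hHomotopy_eq_zero_of_pos {d n : ℕ} (hd : 1 ≤ d) {A₀ A : RealTensor (d + 1) n}
    (hA₀ : ∀ I, 0 < A₀ I) (hA : ∀ I, 0 ≤ A I) (hirr : WeaklyIrreducible A) {t : ℝ}
    (ht : t ∈ Set.Icc (0 : ℝ) 1) {p q : (Fin n → ℝ) × ℝ} (hp : ∀ i, 0 < p.1 i)
    (hpt : hHomotopy A₀ A p t = 0) (hq : ∀ i, 0 < q.1 i) (hqt : hHomotopy A₀ A q t = 0) : q = p :=
  eq_of_hMap_eq_zero_of_pos (homotopyTensor_nonneg hA₀ hA ht)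
    (homotopyTensor_weaklyIrreducible hd hA₀ hA hirr ht) hp hpt hq hqt

/-- At a nondegenerate zero the map `(p, t) ↦ (G (p, t), t)` is locally onto, so zeros of `G (·, t)`
persist for `t` near `t₀`. -/
theorem eventually_exists_zero_of_injective {E : Type*} [NormedAddCommGroup E] [NormedSpace ℝ E]
    [FiniteDimensional ℝ E] {G : E × ℝ → E} (hG : ContDiff ℝ 1 G) {p : E} {t₀ : ℝ}
    (h0 : G (p, t₀) = 0)
    (hinj : Function.Injective (fderiv ℝ (fun q => G (q, t₀)) p)) {V : Set E} (hV : V ∈ 𝓝 p) :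
    ∀ᶠ t in 𝓝 t₀, ∃ q ∈ V, G (q, t) = 0 := by
  have : CompleteSpace E := FiniteDimensional.complete ℝ E
  let Φ : E × ℝ → E × ℝ := fun q => (G q, q.2)
  have hGs := hG.contDiffAt.hasStrictFDerivAt (x := (p, t₀)) one_ne_zero
  have hΦ := hGs.prodMk (hasStrictFDerivAt_snd (𝕜 := ℝ) (p := (p, t₀)))
  have hpart : fderiv ℝ (fun q => G (q, t₀)) p =
      (fderiv ℝ G (p, t₀)).comp (ContinuousLinearMap.inl ℝ E ℝ) :=
    (hGs.hasFDerivAt.comp p (hasFDerivAt_prodMk_left p t₀)).fderiv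
  have hinjΦ : Function.Injective
      ((fderiv ℝ G (p, t₀)).prod (ContinuousLinearMap.snd ℝ E ℝ)) := by
    rw [injective_iff_map_eq_zero]
    rintro ⟨v, τ⟩ hv
    simp only [ContinuousLinearMap.prod_apply, ContinuousLinearMap.coe_snd', Prod.mk_eq_zero] at hv
    obtain ⟨hv, rfl⟩ := hv
    have : v = 0 := (injective_iff_map_eq_zero _).1 hinj v (by rw [hpart]; simpa using hv)
    rw [this]; rfl
  have hmap := hΦ.map_nhds_eq_of_surj
    (LinearMap.range_eq_top.2 (LinearMap.injective_iff_surjective.1 hinjΦ))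
  have hmem : Φ '' (Prod.fst ⁻¹' V) ∈ 𝓝 ((0 : E), t₀) := by
    rw [← h0]
    exact hmap ▸ image_mem_map (continuous_fst.continuousAt hV)
  have hcont : Tendsto (fun t : ℝ => ((0 : E), t)) (𝓝 t₀) (𝓝 ((0 : E), t₀)) :=
    (Continuous.prodMk_right (0 : E)).continuousAt
  filter_upwards [hcont hmem] with t ⟨⟨q, s⟩, hqV, hq⟩
  simp only [Φ, Prod.mk.injEq] at hq
  exact ⟨q, hqV, hq.2 ▸ hq.1⟩

theorem eventually_exists_pos_zero {d n : ℕ} (hd : 1 ≤ d) {A₀ A : RealTensor (d + 1) n}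
    (hA₀ : ∀ I, 0 < A₀ I) (hA : ∀ I, 0 ≤ A I) (hirr : WeaklyIrreducible A) {t₀ : ℝ}
    (ht₀ : t₀ ∈ Set.Icc (0 : ℝ) 1) {p : (Fin n → ℝ) × ℝ} (hp : ∀ i, 0 < p.1 i)
    (hpt : hHomotopy A₀ A p t₀ = 0) {V : Set ((Fin n → ℝ) × ℝ)} (hV : V ∈ 𝓝 p) :
    ∀ᶠ t in 𝓝 t₀, ∃ q ∈ V, (∀ i, 0 < q.1 i) ∧ hHomotopy A₀ A q t = 0 := by
  have hpos : ∀ᶠ q : (Fin n → ℝ) × ℝ in 𝓝 p, ∀ i, 0 < q.1 i := eventually_all.2 fun i =>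
    (continuous_apply i |>.comp continuous_fst).continuousAt.eventually_const_lt (hp i)
  have h := eventually_exists_zero_of_injective (contDiff_hHomotopy A₀ A) hpt
    (fderiv_hMap_injective (homotopyTensor_nonneg hA₀ hA ht₀)
      (homotopyTensor_weaklyIrreducible hd hA₀ hA hirr ht₀) hp hpt) (inter_mem hV hpos)
  filter_upwards [h] with t ⟨q, hq, hqt⟩
  exact ⟨q, hq.1, hq.2, hqt⟩

/-- All positive solutions of the homotopy lie in one compact set of positive pairs. -/
theorem exists_compact_bound {d n : ℕ} (hd : 1 ≤ d) [Nonempty (Fin n)]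
    {A₀ A : RealTensor (d + 1) n} (hA₀ : ∀ I, 0 < A₀ I) (hA : ∀ I, 0 ≤ A I)
    (hirr : WeaklyIrreducible A) :
    ∃ K : Set ((Fin n → ℝ) × ℝ), IsCompact K ∧ (∀ p ∈ K, ∀ i, 0 < p.1 i) ∧
      ∀ t ∈ Set.Icc (0 : ℝ) 1, ∀ p, (∀ i, 0 < p.1 i) → hHomotopy A₀ A p t = 0 → p ∈ K := by
  have hexists (B : RealTensor (d + 1) n) (hB : ∀ I, 0 ≤ B I) : ∃ a > 0, ∀ I, B I ≠ 0 → a ≤ B I := by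
    by_cases hne : ∃ I, B I ≠ 0
    · obtain ⟨I, hI, hmin⟩ := Set.exists_min_image {I | B I ≠ 0} B (Set.toFinite _) hne
      exact ⟨B I, (hB I).lt_of_ne' hI, hmin⟩
    · exact ⟨1, one_pos, fun I hI => (hne ⟨I, hI⟩).elim⟩
  obtain ⟨a₀, ha₀, hA₀a⟩ := hexists A₀ fun I => (hA₀ I).le
  obtain ⟨a, ha, hAa⟩ := hexists A hA
  set Λ : ℝ := ∑ I, (A₀ I + A I)
  have hΛ : 0 ≤ Λ := Finset.sum_nonneg fun I _ => add_nonneg (hA₀ I).le (hA I)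
  obtain ⟨C₀, hC₀, hb₀⟩ :=
    (weaklyIrreducible_of_pos hd hA₀).exists_ratio_bound (half_pos ha₀) hΛ
  obtain ⟨C₁, hC₁, hb₁⟩ := hirr.exists_ratio_bound (half_pos ha) hΛ
  set C := max C₀ C₁
  -- The last condition is what `1 = ∑ i, x i ^ 2` and `x i ≤ C * x j` give for each `j`.
  refine ⟨(Set.Icc 0 1 ×ˢ Set.Icc 0 Λ) ∩ {p | ∀ j, 1 ≤ n * (C * p.1 j) ^ 2},
    (isCompact_Icc.prod isCompact_Icc).inter_right ?_, ?_, ?_⟩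
  · simp only [Set.ofPred_forall]
    exact isClosed_iInter fun j => isClosed_le continuous_const (by fun_prop)
  · rintro ⟨x, l⟩ ⟨⟨hx, -⟩, hj⟩ i
    refine (hx.1 i).lt_of_ne' fun h => ?_
    have := hj i
    simp only at h
    norm_num [h] at this
  · rintro t ht ⟨x, l⟩ hx hxt
    obtain ⟨hxl, hx1⟩ := hMap_eq_zero_iff.1 hxt
    simp only at hx hxl hx1
    have hnn := homotopyTensor_nonneg hA₀ hA ht
    have hle (I) : homotopyTensor A₀ A t I ≤ A₀ I + A I := add_le_add
      (mul_le_of_le_one_left (hA₀ I).le (by linarith [ht.1])) (mul_le_of_le_one_left (hA I) ht.2)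
    have hlΛ : l ≤ Λ := (eigenvalue_le_sum hnn hx hxl).trans (Finset.sum_le_sum fun I _ => hle I)
    have hsup (i) : tensorApply (homotopyTensor A₀ A t) x i ≤ Λ * x i ^ d :=
      (hxl i).trans_le (mul_le_mul_of_nonneg_right hlΛ (pow_pos (hx i) d).le)
    -- At least half of `A₀` survives for `t ≤ 1 / 2`, and at least half of `A` for `t ≥ 1 / 2`.
    have hratio (i j) : x i ≤ C * x j := by
      rcases le_total t (1 / 2) with h | h
      · refine (hb₀ _ hnn (fun I hI => ?_) x hx hsup i j).trans
          (mul_le_mul_of_nonneg_right (le_max_left _ _) (hx j).le)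
        have h1 : 1 / 2 * a₀ ≤ (1 - t) * A₀ I :=
          mul_le_mul (by linarith) (hA₀a I hI) ha₀.le (by linarith)
        have h2 : 0 ≤ t * A I := mul_nonneg ht.1 (hA I)
        simp only [Pi.add_apply, Pi.smul_apply, smul_eq_mul]
        linarith
      · refine (hb₁ _ hnn (fun I hI => ?_) x hx hsup i j).trans
          (mul_le_mul_of_nonneg_right (le_max_right _ _) (hx j).le)
        have h1 : 1 / 2 * a ≤ t * A I := mul_le_mul h (hAa I hI) ha.le ht.1
        have h2 : 0 ≤ (1 - t) * A₀ I := mul_nonneg (sub_nonneg.2 ht.2) (hA₀ I).le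
        simp only [Pi.add_apply, Pi.smul_apply, smul_eq_mul]
        linarith
    refine ⟨⟨⟨fun i => (hx i).le, fun i => ?_⟩, eigenvalue_nonneg hnn hx (Classical.arbitrary _)
      (hxl _), hlΛ⟩, fun j => ?_⟩
    · have : x i * x i ≤ x ⬝ᵥ x :=
        Finset.single_le_sum (f := fun i => x i * x i) (fun i _ => mul_self_nonneg _)
          (Finset.mem_univ i)
      simp only [Pi.one_apply]
      nlinarith
    · rw [← hx1, dotProduct]
      calc ∑ i, x i * x i ≤ ∑ _i : Fin n, (C * x j) ^ 2 := by
            refine Finset.sum_le_sum fun i _ => ?_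
            rw [sq]
            exact mul_self_le_mul_self (hx i).le (hratio i j)
        _ = n * (C * x j) ^ 2 := by simp

/-- Positive solutions exist for every `t`: the set of such `t` is open by nondegeneracy and closed
by compactness. -/
theorem exists_pos_zero {d n : ℕ} (hd : 1 ≤ d) [Nonempty (Fin n)]
    {A₀ A : RealTensor (d + 1) n} (hA₀ : ∀ I, 0 < A₀ I) (hA : ∀ I, 0 ≤ A I)
    (hirr : WeaklyIrreducible A)
    (h0 : ∃ p : (Fin n → ℝ) × ℝ, (∀ i, 0 < p.1 i) ∧ hHomotopy A₀ A p 0 = 0) :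
    ∀ t ∈ Set.Icc (0 : ℝ) 1, ∃ p : (Fin n → ℝ) × ℝ, (∀ i, 0 < p.1 i) ∧ hHomotopy A₀ A p t = 0 := by
  obtain ⟨K, hK, hKpos, hKmem⟩ := exists_compact_bound hd hA₀ hA hirr
  set T : Set ℝ := {t | ∃ p : (Fin n → ℝ) × ℝ, (∀ i, 0 < p.1 i) ∧ hHomotopy A₀ A p t = 0}
  have hTK : T ∩ Set.Icc 0 1 =
      Prod.snd '' ((K ×ˢ Set.Icc (0 : ℝ) 1) ∩ {q | hHomotopy A₀ A q.1 q.2 = 0}) := by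
    ext t
    constructor
    · rintro ⟨⟨p, hp, hpt⟩, ht⟩
      exact ⟨(p, t), ⟨⟨hKmem t ht p hp hpt, ht⟩, hpt⟩, rfl⟩
    · rintro ⟨⟨p, t⟩, ⟨⟨hp, ht⟩, hpt⟩, rfl⟩
      exact ⟨⟨p, hKpos p hp, hpt⟩, ht⟩
  have hclosed : IsClosed (T ∩ Set.Icc 0 1) := by
    rw [hTK]
    exact (((hK.prod isCompact_Icc).inter_right (isClosed_eq
      (contDiff_hHomotopy A₀ A).continuous continuous_const)).image continuous_snd).isClosed
  refine hclosed.Icc_subset_of_forall_mem_nhdsWithin h0 ?_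
  rintro t ⟨⟨p, hp, hpt⟩, ht⟩
  refine mem_nhdsWithin_of_mem_nhds ?_
  filter_upwards [eventually_exists_pos_zero hd hA₀ hA hirr ⟨ht.1, ht.2.le⟩ hp hpt univ_mem]
    with s ⟨q, _, hq⟩
  exact ⟨q, hq⟩

theorem exists_pos_curve {d n : ℕ} (hd : 1 ≤ d) [Nonempty (Fin n)]
    {A₀ A : RealTensor (d + 1) n} (hA₀ : ∀ I, 0 < A₀ I) (hA : ∀ I, 0 ≤ A I)
    (hirr : WeaklyIrreducible A)
    (h0 : ∃ p : (Fin n → ℝ) × ℝ, (∀ i, 0 < p.1 i) ∧ hHomotopy A₀ A p 0 = 0) :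
    ∃ c : ℝ → (Fin n → ℝ) × ℝ, ContinuousOn c (Set.Icc 0 1) ∧
      ∀ t ∈ Set.Icc (0 : ℝ) 1, (∀ i, 0 < (c t).1 i) ∧ hHomotopy A₀ A (c t) t = 0 := by
  choose! c hc using exists_pos_zero hd hA₀ hA hirr h0
  refine ⟨c, fun t ht V hV => ?_, hc⟩
  change ∀ᶠ s in 𝓝[Set.Icc 0 1] t, c s ∈ V
  -- The solution produced near `c t` by persistence is `c s`, by uniqueness.
  filter_upwards [mem_nhdsWithin_of_mem_nhds (eventually_exists_pos_zero hd hA₀ hA hirr ht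
    (hc t ht).1 (hc t ht).2 hV), self_mem_nhdsWithin] with s ⟨q, hqV, hq, hqs⟩ hs
  rwa [eq_of_hHomotopy_eq_zero_of_pos hd hA₀ hA hirr hs hq hqs (hc s hs).1 (hc s hs).2]

/-- A continuous solution curve that starts at a positive solution stays on the curve of positive
solutions: the agreement set is closed, and open because positivity is an open condition and the
positive solution is unique. -/
theorem eqOn_pos_curve {d n : ℕ} (hd : 1 ≤ d) {A₀ A : RealTensor (d + 1) n}
    (hA₀ : ∀ I, 0 < A₀ I) (hA : ∀ I, 0 ≤ A I) (hirr : WeaklyIrreducible A)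
    {c e : ℝ → (Fin n → ℝ) × ℝ} (hc : ContinuousOn c (Set.Icc 0 1))
    (hcpos : ∀ t ∈ Set.Icc (0 : ℝ) 1, (∀ i, 0 < (c t).1 i) ∧ hHomotopy A₀ A (c t) t = 0)
    (he : ContinuousOn e (Set.Ico 0 1)) (he0 : e 0 = c 0)
    (hezero : ∀ t ∈ Set.Ico (0 : ℝ) 1, hHomotopy A₀ A (e t) t = 0) :
    Set.EqOn e c (Set.Ico 0 1) := by
  intro t ht
  have hsub : Set.Icc 0 t ⊆ Set.Ico (0 : ℝ) 1 := Set.Icc_subset_Ico_right ht.2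
  have hclosed : IsClosed ({s | e s = c s} ∩ Set.Icc 0 t) := by
    have h := ((he.mono hsub).prodMk (hc.mono (hsub.trans
      Set.Ico_subset_Icc_self))).preimage_isClosed_of_isClosed isClosed_Icc isClosed_diagonal
    rwa [Set.inter_comm] at h
  refine hclosed.Icc_subset_of_forall_mem_nhdsWithin he0 ?_ (Set.right_mem_Icc.2 ht.1)
  rintro s ⟨hs : e s = c s, hs0, hst⟩
  have hs1 : s < 1 := hst.trans ht.2
  have hIoo : Set.Ioo s 1 ∈ 𝓝[>] s := Ioo_mem_nhdsGT hs1
  have hcont : Tendsto e (𝓝[>] s) (𝓝 (e s)) :=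
    (he s ⟨hs0, hs1⟩).mono_left (nhdsWithin_le_of_mem (mem_of_superset hIoo fun r hr =>
      ⟨hs0.trans hr.1.le, hr.2⟩))
  have hpos : ∀ᶠ r in 𝓝[>] s, ∀ i, 0 < (e r).1 i := eventually_all.2 fun i =>
    (((continuous_apply i).comp continuous_fst).tendsto _ |>.comp hcont).eventually_const_lt
      (hs ▸ (hcpos s ⟨hs0, hs1.le⟩).1 i)
  filter_upwards [hpos, hIoo] with r hr hrI
  have hr0 : 0 ≤ r := hs0.trans hrI.1.le
  exact eq_of_hHomotopy_eq_zero_of_pos hd hA₀ hA hirr ⟨hr0, hrI.2.le⟩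
    (hcpos r ⟨hr0, hrI.2.le⟩).1 (hcpos r ⟨hr0, hrI.2.le⟩).2 hr (hezero r ⟨hr0, hrI.2⟩)

/-! ### The starting point -/

theorem rankOne_pos {m n : ℕ} {u : Fin m → Fin n → ℝ} (hu : ∀ k i, 0 < u k i)
    (I : Fin m → Fin n) : 0 < rankOne u I :=
  Finset.prod_pos fun k _ => hu k (I k)

theorem hStart_spec {d n : ℕ} (hd : 1 ≤ d) [Nonempty (Fin n)] {u : Fin (d + 1) → Fin n → ℝ}
    (hu : ∀ k i, 0 < u k i) (A : RealTensor (d + 1) n) :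
    (∀ i, 0 < (hStart u).1 i) ∧ hHomotopy (rankOne u) A (hStart u) 0 = 0 := by
  have hr (i) : 0 < rootVector u i := Real.rpow_pos_of_pos (hu 0 i) _
  have hrd (i) : rootVector u i ^ d = u 0 i := by
    rw [rootVector, one_div, Real.rpow_inv_natCast_pow (hu 0 i).le (by omega)]
  have hdot : 0 < rootVector u ⬝ᵥ rootVector u :=
    Finset.sum_pos (fun i _ => mul_pos (hr i) (hr i)) Finset.univ_nonempty
  have hsq := Real.sqrt_pos.2 hdot
  refine ⟨fun i => mul_pos (inv_pos.2 hsq) (hr i), ?_⟩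
  have h0 : hHomotopy (rankOne u) A (hStart u) 0 = hMap (rankOne u) (hStart u) := by
    simp [hHomotopy]
  rw [h0, hMap_eq_zero_iff]
  refine ⟨fun i => ?_, ?_⟩
  · simp only [hStart]
    rw [tensorApply_smul, tensorApply_rankOne, Pi.smul_apply, smul_eq_mul, mul_pow, hrd]
    ring
  · simp only [hStart, smul_dotProduct, dotProduct_smul, smul_eq_mul]
    rw [← mul_assoc, ← mul_inv, Real.mul_self_sqrt hdot.le, inv_mul_cancel₀ hdot.ne']

/-! ### The homotopy theorem -/

theorem theorem2p4 (d n : ℕ) (hd : 1 ≤ d) (A : RealTensor (d + 1) n)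
    (hA : ∀ I, 0 ≤ A I) (hA0 : A ≠ 0) (hirr : WeaklyIrreducible A) :
    ∃ (xs : Fin n → ℝ) (ls : ℝ),
      -- a positive normalized H-eigenpair, that is, a positive solution of `F_H = 0`
      (∀ i, 0 < xs i) ∧ 0 < ls ∧ IsHEigenpair A ls xs ∧ hMap A (xs, ls) = 0 ∧
      -- it is the only one with a positive vector, and up to scaling the only positive H-eigenpair
      (∀ x l, (∀ i, 0 < x i) → hMap A (x, l) = 0 → x = xs ∧ l = ls) ∧
      (∀ x l, (∀ i, 0 < x i) → IsHEigenpair A l x → l = ls ∧ ∃ a : ℝ, 0 < a ∧ x = a • xs) ∧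
      -- `xs` is the only nonnegative solution at the eigenvalue `ls`
      (∀ x, (∀ i, 0 ≤ x i) → hMap A (x, ls) = 0 → x = xs) ∧
      -- the Jacobian is invertible there, and the solution is isolated
      (fderiv ℝ (hMap A) (xs, ls)).IsInvertible ∧
      IsIsolatedZero (hMap A) (xs, ls) ∧
      -- the homotopy curve exists, is unique on `[0, 1)`, and converges to this pair
      ∀ u : Fin (d + 1) → Fin n → ℝ, (∀ k i, 0 < u k i) →
        (∃ c, IsHCurve u A c) ∧
        (∀ c c', IsHCurve u A c → IsHCurve u A c' → Set.EqOn c c' (Set.Ico 0 1)) ∧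
        ∀ c, IsHCurve u A c → Tendsto c (𝓝[<] 1) (𝓝 (xs, ls)) := by
  obtain ⟨I, hI⟩ := Function.ne_iff.1 hA0
  have hne : Nonempty (Fin n) := ⟨I 0⟩
  have h01 : (0 : ℝ) ∈ Set.Icc (0 : ℝ) 1 := Set.left_mem_Icc.2 zero_le_one
  have h11 : (1 : ℝ) ∈ Set.Icc (0 : ℝ) 1 := Set.right_mem_Icc.2 zero_le_one
  have hend (A₀ : RealTensor (d + 1) n) (p) : hHomotopy A₀ A p 1 = hMap A p := by simp [hHomotopy]
  -- Existence: follow the homotopy from the all-ones tensor.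
  obtain ⟨⟨xs, ls⟩, hpos, hzero⟩ : ∃ p : (Fin n → ℝ) × ℝ, (∀ i, 0 < p.1 i) ∧ hMap A p = 0 := by
    have hone : ∀ (k : Fin (d + 1)) (i : Fin n), (0 : ℝ) < (fun _ _ => 1) k i :=
      fun _ _ => one_pos
    obtain ⟨p, hp, hp0⟩ := exists_pos_zero hd (rankOne_pos hone) hA hirr
      ⟨_, hStart_spec hd hone A⟩ 1 h11
    exact ⟨p, hp, hend _ p ▸ hp0⟩
  simp only at hpos
  obtain ⟨heig, hnorm⟩ := hMap_eq_zero_iff.1 hzero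
  simp only at heig hnorm
  have hxs0 : xs ≠ 0 := by rintro rfl; simp at hnorm
  have hinv := isInvertible_of_injective (fderiv_hMap_injective hA hirr hpos hzero)
  refine ⟨xs, ls, hpos, ?_, ⟨hxs0, funext heig⟩, hzero, fun x l hx hxl => ?_,
    fun x l hx ⟨hx0, hxl⟩ => ?_,
    fun x hx hxl => eq_of_hMap_eq_zero_of_nonneg hA hirr hpos hzero hx hxl, hinv,
    isIsolatedZero_of_isInvertible ((contDiff_hMap A).differentiable one_ne_zero _) hinv hzero,
    fun u hu => ?_⟩
  · have h : 0 < tensorApply A xs (I 0) :=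
      (mul_pos ((hA I).lt_of_ne' hI) (Finset.prod_pos fun k _ => hpos _)).trans_le
        (mul_prod_le_tensorApply hA (fun i => (hpos i).le) I)
    rw [heig] at h
    exact pos_of_mul_pos_left h (pow_pos (hpos _) d).le
  · exact Prod.mk.inj (eq_of_hMap_eq_zero_of_pos hA hirr (p := (xs, ls)) hpos hzero
      (q := (x, l)) hx hxl)
  · obtain rfl := eigenvalue_eq_of_pos hA hpos hxs0 heig hx hx0 (congrFun hxl)
    exact ⟨rfl, exists_eq_smul_of_eigenvalue_eq hA hirr hpos heig (fun i => (hx i).le) hx0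
      (congrFun hxl)⟩
  · have hA₀ := rankOne_pos hu
    have hstart := hStart_spec hd hu A
    obtain ⟨c, hc, hcpos⟩ := exists_pos_curve hd hA₀ hA hirr ⟨_, hstart⟩
    have hc0 : c 0 = hStart u := eq_of_hHomotopy_eq_zero_of_pos hd hA₀ hA hirr h01
      hstart.1 hstart.2 (hcpos 0 h01).1 (hcpos 0 h01).2
    have hc1 : c 1 = (xs, ls) := eq_of_hMap_eq_zero_of_pos hA hirr hpos hzero (hcpos 1 h11).1
      (hend _ (c 1) ▸ (hcpos 1 h11).2)
    have heq (e) (he : IsHCurve u A e) : Set.EqOn e c (Set.Ico 0 1) :=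
      eqOn_pos_curve hd hA₀ hA hirr hc hcpos he.1 (he.2.1.trans hc0.symm) he.2.2
    refine ⟨⟨c, hc.mono Set.Ico_subset_Icc_self, hc0,
      fun t ht => (hcpos t (Set.Ico_subset_Icc_self ht)).2⟩,
      fun e e' he he' => (heq e he).trans (heq e' he').symm, fun e he => ?_⟩
    have hlt : Set.Ico (0 : ℝ) 1 ∈ 𝓝[<] 1 := Ico_mem_nhdsLT zero_lt_one
    have hlim : Tendsto c (𝓝[<] 1) (𝓝 (c 1)) := (hc 1 h11).mono_left
      (nhdsWithin_le_of_mem (mem_of_superset hlt Set.Ico_subset_Icc_self))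
    rw [← hc1]
    exact hlim.congr' (mem_of_superset hlt fun t ht => (heq e he ht).symm)
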